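/- Let ${\bf D}=\{x+\tau y : x,y\in{\bf R}\}$, $\tau^2=1$, be the double numbers, with $\overline{x+\tau y}=x-\tau y$. On ${\bf D}^n$ put $\langle z,w\rangle={\rm Re}\sum_j z_j\bar w_j$ (of signature $(n,n)$), $\omega(z,w)=-{\rm Im}\sum_j z_j\bar w_j=\sum_j (dx_j\wedge dy_j)(z,w)$, ${\bf T}z=\tau z$ and $dz=dz_1\wedge\cdots\wedge dz_n$. Let $M$ be a connected oriented smooth $n$-dimensional (embedded or immersed) submanifold of ${\bf D}^n$ that is Lagrangian ($\omega|_M=0$) and non-degenerate (the induced metric is non-degenerate at every point). Let $q$ be the number of negative signs in the signature of the induced metric, ${\rm dvol}_M$ the volume form of $M$ (value $1$ on oriented orthonormal frames), and $H=\sum_{i,j}g^{ij}(\partial_i\partial_j f)^{\rm normal}$ (where $f$ is a local parametrization and $g_{ij}=\langle \partial_i f,\partial_j f\rangle$) the mean curvature vector, i.e. the trace of the second fundamental form. Then there is exactly one function $\theta:M\to{\bf R}$ (the phase function of $M$) such that, for one choice of the sign $\pm$ on all of $M$, $$\pm\,\tau^q\,dz\big|_M = e^{\tau\theta}\,{\rm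 dvol}_M .$$ This $\theta$ is smooth, and for every tangent vector $V$ of $M$ $$V(\theta) = -\langle {\bf T}V,H\rangle = -\omega(H,V), \qquad\hbox{i.e.}\quad d\theta=-\,H\,\lrcorner\,\omega .$$ Moreover, $M$ has mean curvature zero ($H\equiv 0$) if and only if its phase function $\theta$ is constant. -/

import Mathlib

open scoped Manifold ContDiff Topology

noncomputable section

namespace SplitLag

/-! ## Double numbers and double `n`-space -/

/-- The algebra `D` of double numbers, written in null coordinates `(u, v)`: as a real algebra it is
`ℝ × ℝ` with componentwise operations (`e = (1, 0)` and `ē = (0, 1)` are the two idempotents). -/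
abbrev DoubleNumber : Type := ℝ × ℝ

/-- The generator `τ = -e + ē`. -/
def tau : DoubleNumber := (-1, 1)

theorem tau_mul_tau : tau * tau = 1 := by
  ext <;> simp [tau]

/-- The real part `x` of `x + τ y`. -/
def re (z : DoubleNumber) : ℝ := (z.1 + z.2) / 2

/-- The imaginary part `y` of `x + τ y`. -/
def im (z : DoubleNumber) : ℝ := (z.2 - z.1) / 2

/-- Every double number is `x + τ y` with `x = re z` and `y = im z`. -/
theorem re_add_tau_mul_im (z : DoubleNumber) :
    re z • (1 : DoubleNumber) + im z • tau = z := by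
  ext <;> simp [tau, re, im] <;> ring

/-- Conjugation `x + τ y ↦ x - τ y`. -/
def conj (z : DoubleNumber) : DoubleNumber := (z.2, z.1)

/-- Double `n`-space `Dⁿ`, with its structure of a `2n`-dimensional real vector space. (Its norm is
used only for the smooth structure.) -/
abbrev DSpace (n : ℕ) : Type := Fin n → DoubleNumber

variable {n : ℕ}

/-- The `D`-valued hermitian form `(z, w) = ∑ z_j w̄_j`. -/
def hermitianForm (z w : DSpace n) : DoubleNumber := ∑ j, z j * conj (w j)

/-- The real inner product `⟨z, w⟩ = Re (z, w)`, of signature `(n, n)`. -/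
def innerD (z w : DSpace n) : ℝ := re (hermitianForm z w)

/-- The symplectic form `ω = ∑ dx_j ∧ dy_j = -Im (·, ·)`. -/
def omega (z w : DSpace n) : ℝ := -im (hermitianForm z w)

/-- The operator `T z = τ z`. -/
def opT (z : DSpace n) : DSpace n := fun j => tau * z j

/-- The `D`-valued `n`-form `dz = dz₁ ∧ ⋯ ∧ dz_n`. -/
def dz (v : Fin n → DSpace n) : DoubleNumber := Matrix.det (Matrix.of fun i j => v i j)

/-! ## Oriented non-degenerate Lagrangian submanifolds -/

variable {M : Type*} [TopologicalSpace M] [ChartedSpace (EuclideanSpace ℝ (Fin n)) M]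

/-- The differential of `f : M → Dⁿ` at `x`, which identifies tangent vectors of `M` with vectors
of `Dⁿ`. -/
def differential (f : M → DSpace n) (x : M) : TangentSpace (𝓡 n) x →L[ℝ] DSpace n :=
  mfderiv (𝓡 n) 𝓘(ℝ, DSpace n) f x

/-- The first fundamental form of `f`, i.e. the metric induced on the tangent space at `x`. -/
def firstForm (f : M → DSpace n) (x : M) (v w : TangentSpace (𝓡 n) x) : ℝ :=
  innerD (differential f x v) (differential f x w)

/-- `f : M → Dⁿ` presents the `n`-manifold `M` as a smooth (immersed) Lagrangian submanifold on
which the induced metric is non-degenerate. -/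
structure IsNondegenerateLagrangian (f : M → DSpace n) : Prop where
  smooth : ContMDiff (𝓡 n) 𝓘(ℝ, DSpace n) ∞ f
  immersion : ∀ x, Function.Injective (differential f x)
  lagrangian : ∀ x (v w : TangentSpace (𝓡 n) x),
    omega (differential f x v) (differential f x w) = 0
  nondegenerate : ∀ x (v : TangentSpace (𝓡 n) x), (∀ w, firstForm f x v w = 0) → v = 0

/-- A field of orientations of the tangent spaces of a smooth manifold `M` is an orientation of `M`
if it is locally constant when the tangent spaces near `x₀` are identified with `ℝⁿ` by the
derivative of the chart at `x₀` (for the point `x₀` itself this identification is the identity). -/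
def IsManifoldOrientation [IsManifold (𝓡 n) ∞ M]
    (o : ∀ x : M, Orientation ℝ (TangentSpace (𝓡 n) x) (Fin n)) : Prop :=
  ∀ x₀ : M, ∀ᶠ y in 𝓝 x₀,
    ∀ hy : y ∈ (trivializationAt (EuclideanSpace ℝ (Fin n)) (TangentSpace (𝓡 n)) x₀).baseSet,
      Orientation.map (Fin n)
        ((trivializationAt (EuclideanSpace ℝ (Fin n)) (TangentSpace (𝓡 n)) x₀).continuousLinearEquivAt
          ℝ y hy).toLinearEquiv (o y) = o x₀

/-! ## The phase function -/

/-- A basis of the tangent space at `x` which is orthonormal for the induced (indefinite) metric. -/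
def IsOrthonormalFrame (f : M → DSpace n) (x : M)
    (e : Module.Basis (Fin n) ℝ (TangentSpace (𝓡 n) x)) : Prop :=
  (∀ i j, i ≠ j → firstForm f x (e i) (e j) = 0) ∧
    ∀ i, firstForm f x (e i) (e i) = 1 ∨ firstForm f x (e i) (e i) = -1

open Classical in
/-- The number of time-like vectors of a frame. For an orthonormal frame at a point where the
induced metric has signature `(p, q)` it is `q`. -/
def numTimelike (f : M → DSpace n) (x : M)
    (e : Module.Basis (Fin n) ℝ (TangentSpace (𝓡 n) x)) : ℕ :=
  (Finset.univ.filter fun i => firstForm f x (e i) (e i) < 0).card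

open Classical in
/-- The value of the volume form of `M` on an orthonormal frame `e` at `x`: it is `1` if `e` is
positively oriented and `-1` otherwise. -/
def volumeOnFrame (o : ∀ x : M, Orientation ℝ (TangentSpace (𝓡 n) x) (Fin n)) (x : M)
    (e : Module.Basis (Fin n) ℝ (TangentSpace (𝓡 n) x)) : ℝ :=
  if e.orientation = o x then 1 else -1

/-- `θ : M → ℝ` is the phase function of the oriented non-degenerate Lagrangian submanifold `f`:
`± τ^q dz|_M = e^{τ θ} dvol_M` with one sign for the whole of `M`. Both sides are
`n`-forms, so that they are compared on orthonormal frames. -/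
def IsPhaseFunction (f : M → DSpace n)
    (o : ∀ x : M, Orientation ℝ (TangentSpace (𝓡 n) x) (Fin n)) (θ : M → ℝ) : Prop :=
  ∃ σ : ℝ, (σ = 1 ∨ σ = -1) ∧
    ∀ (x : M) (e : Module.Basis (Fin n) ℝ (TangentSpace (𝓡 n) x)), IsOrthonormalFrame f x e →
      σ • (tau ^ numTimelike f x e * dz fun i => differential f x (e i)) =
        volumeOnFrame o x e • NormedSpace.exp (θ x • tau)

/-! ## The mean curvature vector -/

/-- The `i`-th coordinate vector of the chart at `x`, as a tangent vector at `x`. -/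
def coordVec (x : M) (i : Fin n) : TangentSpace (𝓡 n) x :=
  (EuclideanSpace.single i 1 : EuclideanSpace ℝ (Fin n))

/-- The Gram matrix `g_{ij} = ⟨∂_i f, ∂_j f⟩` at `x`, in the chart at `x`. -/
def gram (f : M → DSpace n) (x : M) : Matrix (Fin n) (Fin n) ℝ :=
  Matrix.of fun i j => firstForm f x (coordVec x i) (coordVec x j)

/-- The second partial derivative `∂_i ∂_j f` at `x`, in the chart at `x`. -/
def secondDeriv (f : M → DSpace n) (x : M) (i j : Fin n) : DSpace n :=
  fderiv ℝ (fderiv ℝ (f ∘ (extChartAt (𝓡 n) x).symm)) (extChartAt (𝓡 n) x x)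
    (EuclideanSpace.single i 1) (EuclideanSpace.single j 1)

/-- The component of `w` normal to `M` at `x`: `w - ∑ g^{kl} ⟨w, ∂_k f⟩ ∂_l f`. -/
def normalPart (f : M → DSpace n) (x : M) (w : DSpace n) : DSpace n :=
  w - ∑ k, ∑ l, ((gram f x)⁻¹ k l * innerD w (differential f x (coordVec x k))) •
    differential f x (coordVec x l)

/-- The mean curvature vector: the trace `∑ g^{ij} (∂_i ∂_j f)^{normal}` of the second fundamental
form (the ambient metric has constant coefficients, so that its connection is the flat one). -/
def meanCurvature (f : M → DSpace n) (x : M) : DSpace n :=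
  ∑ i, ∑ j, (gram f x)⁻¹ i j • normalPart f x (secondDeriv f x i j)

end SplitLag

end

open scoped Manifold ContDiff Topology

noncomputable section

namespace SplitLag

variable {n : ℕ}

/-! ## Null coordinates -/

/-! In null coordinates `D` is `ℝ × ℝ`, and a frame `w` of a tangent space becomes two real matrices
`A`, `B`, with `dz w = (det A, det B)`. The Lagrangian condition says exactly that `A Bᵀ` is
symmetric, and then `A Bᵀ` is the Gram matrix `G`. So `det A * det B = det G`, which is `(-1)^q` on
an orthonormal frame. As `τ^q = ((-1)^q, 1)`, this gives `τ^q dz = ((det B)⁻¹, det B)`, which is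
`±e^{τθ}` with `θ = log |det B|` (`IsOrthonormalFrame.tau_pow_smul_dz`). The sign, corrected by the
orientation, is independent of the frame and locally constant, hence constant on the connected `M`.

On an arbitrary frame `θ = (log |det B| - log |det A|) / 2`, so smoothness and derivatives can be
read off in coordinate frames. Jacobi's formula, with `B⁻¹ = Aᵀ G⁻¹` and `A⁻¹ = Bᵀ G⁻¹`, gives `θ' =
∑ g^{ij} ω(w_i, w_j')` (`hasDerivAt_phaseOf`). For `w_j = ∂_j f`, symmetry of second derivatives and
the differentiated identity `ω(∂_a f, ∂_b f) = 0` turn this into `-ω(∑ g^{ij} ∂_i ∂_j f, V)`;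
tangential parts do not contribute, so it is `-ω(H, V)`.

Finally, `H` is metrically normal to `M`. If `dθ = 0` it is also `ω`-orthogonal to `M`, and the
invertibility of `A` and `B` forces `H = 0`. -/

/-- The matrix of the first null coordinates of a family of vectors. -/
def nullFst (w : Fin n → DSpace n) : Matrix (Fin n) (Fin n) ℝ := Matrix.of fun i j => (w i j).1

/-- The matrix of the second null coordinates of a family of vectors. -/
def nullSnd (w : Fin n → DSpace n) : Matrix (Fin n) (Fin n) ℝ := Matrix.of fun i j => (w i j).2

theorem dz_eq (w : Fin n → DSpace n) : dz w = ((nullFst w).det, (nullSnd w).det) := by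
  ext
  · exact RingHom.map_det (RingHom.fst ℝ ℝ) _
  · exact RingHom.map_det (RingHom.snd ℝ ℝ) _

theorem innerD_eq (z w : DSpace n) :
    innerD z w = (∑ j, (z j).1 * (w j).2 + ∑ j, (z j).2 * (w j).1) / 2 := by
  simp [innerD, hermitianForm, re, conj, Prod.fst_sum, Prod.snd_sum]

theorem omega_eq (z w : DSpace n) :
    omega z w = (∑ j, (z j).1 * (w j).2 - ∑ j, (z j).2 * (w j).1) / 2 := by
  simp only [omega, hermitianForm, im, conj, Prod.fst_sum, Prod.snd_sum, Prod.fst_mul,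
    Prod.snd_mul]
  ring

theorem innerD_opT (z w : DSpace n) : innerD (opT z) w = omega w z := by
  simp only [innerD_eq, omega_eq, opT, tau, Prod.fst_mul, Prod.snd_mul, ← Finset.sum_add_distrib,
    ← Finset.sum_sub_distrib, Finset.sum_div]
  refine Finset.sum_congr rfl fun j _ => ?_
  ring

/-- The inner product of `Dⁿ` as a bilinear form. -/
def innerBilin (n : ℕ) : LinearMap.BilinForm ℝ (DSpace n) :=
  LinearMap.mk₂ ℝ innerD
    (fun a b c => by
      simp only [innerD_eq, ← Finset.sum_add_distrib, Finset.sum_div, Pi.add_apply, Prod.fst_add,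
        Prod.snd_add]
      exact Finset.sum_congr rfl fun j _ => by ring)
    (fun r a b => by
      simp only [innerD_eq, ← Finset.sum_add_distrib, Finset.sum_div, Pi.smul_apply, Prod.smul_fst,
        Prod.smul_snd, smul_eq_mul, Finset.mul_sum]
      exact Finset.sum_congr rfl fun j _ => by ring)
    (fun a b c => by
      simp only [innerD_eq, ← Finset.sum_add_distrib, Finset.sum_div, Pi.add_apply, Prod.fst_add,
        Prod.snd_add]
      exact Finset.sum_congr rfl fun j _ => by ring)
    (fun r a b => by
      simp only [innerD_eq, ← Finset.sum_add_distrib, Finset.sum_div, Pi.smul_apply, Prod.smul_fst,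
        Prod.smul_snd, smul_eq_mul, Finset.mul_sum]
      exact Finset.sum_congr rfl fun j _ => by ring)

@[simp] theorem innerBilin_apply (z w : DSpace n) : innerBilin n z w = innerD z w := rfl

/-- The symplectic form of `Dⁿ` as a bilinear form. -/
def omegaBilin (n : ℕ) : LinearMap.BilinForm ℝ (DSpace n) :=
  LinearMap.mk₂ ℝ omega
    (fun a b c => by
      simp only [omega_eq, ← Finset.sum_add_distrib, ← Finset.sum_sub_distrib, Finset.sum_div,
        Pi.add_apply, Prod.fst_add, Prod.snd_add]
      exact Finset.sum_congr rfl fun j _ => by ring)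
    (fun r a b => by
      simp only [omega_eq, ← Finset.sum_sub_distrib, Finset.sum_div, Pi.smul_apply, Prod.smul_fst,
        Prod.smul_snd, smul_eq_mul, Finset.mul_sum]
      exact Finset.sum_congr rfl fun j _ => by ring)
    (fun a b c => by
      simp only [omega_eq, ← Finset.sum_add_distrib, ← Finset.sum_sub_distrib, Finset.sum_div,
        Pi.add_apply, Prod.fst_add, Prod.snd_add]
      exact Finset.sum_congr rfl fun j _ => by ring)
    (fun r a b => by
      simp only [omega_eq, ← Finset.sum_sub_distrib, Finset.sum_div, Pi.smul_apply, Prod.smul_fst,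
        Prod.smul_snd, smul_eq_mul, Finset.mul_sum]
      exact Finset.sum_congr rfl fun j _ => by ring)

@[simp] theorem omegaBilin_apply (z w : DSpace n) : omegaBilin n z w = omega z w := rfl

theorem innerD_comm (z w : DSpace n) : innerD z w = innerD w z := by
  rw [innerD_eq, innerD_eq, add_comm]
  simp only [mul_comm]

/-- The Gram matrix of a family of vectors. -/
def gramOf (w : Fin n → DSpace n) : Matrix (Fin n) (Fin n) ℝ :=
  Matrix.of fun i j => innerD (w i) (w j)

theorem gramOf_transpose (w : Fin n → DSpace n) : (gramOf w).transpose = gramOf w := by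
  ext i j
  exact innerD_comm _ _

/-- A family of vectors spanning an isotropic subspace. -/
def IsIsotropic (w : Fin n → DSpace n) : Prop := ∀ i j, omega (w i) (w j) = 0

/-- `innerD` and `omega` are the half sum and the half difference of the same two cross sums; when
`omega` vanishes the cross sums agree, and each equals the inner product. -/
theorem IsIsotropic.nullFst_mul {w : Fin n → DSpace n} (hw : IsIsotropic w) :
    nullFst w * (nullSnd w).transpose = gramOf w := by
  ext i j
  have h := hw i j
  rw [omega_eq] at h
  simp only [Matrix.mul_apply, nullFst, nullSnd, gramOf, Matrix.of_apply, Matrix.transpose_apply,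
    innerD_eq]
  linarith

theorem IsIsotropic.nullSnd_mul {w : Fin n → DSpace n} (hw : IsIsotropic w) :
    nullSnd w * (nullFst w).transpose = gramOf w := by
  rw [← gramOf_transpose, ← hw.nullFst_mul, Matrix.transpose_mul, Matrix.transpose_transpose]

theorem IsIsotropic.det_mul_det {w : Fin n → DSpace n} (hw : IsIsotropic w) :
    (nullFst w).det * (nullSnd w).det = (gramOf w).det := by
  rw [← hw.nullFst_mul, Matrix.det_mul, Matrix.det_transpose]

/-- This brings the inverse metric into Jacobi's formula and leaves no other matrix to invert. -/
theorem IsIsotropic.inv_nullSnd {w : Fin n → DSpace n} (hw : IsIsotropic w)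
    (hg : (gramOf w).det ≠ 0) : (nullSnd w)⁻¹ = (nullFst w).transpose * (gramOf w)⁻¹ := by
  apply Matrix.inv_eq_right_inv
  rw [← Matrix.mul_assoc, hw.nullSnd_mul, Matrix.mul_nonsing_inv _ (isUnit_iff_ne_zero.2 hg)]

theorem IsIsotropic.inv_nullFst {w : Fin n → DSpace n} (hw : IsIsotropic w)
    (hg : (gramOf w).det ≠ 0) : (nullFst w)⁻¹ = (nullSnd w).transpose * (gramOf w)⁻¹ := by
  apply Matrix.inv_eq_right_inv
  rw [← Matrix.mul_assoc, hw.nullFst_mul, Matrix.mul_nonsing_inv _ (isUnit_iff_ne_zero.2 hg)]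

/-- A vector which is orthogonal for both forms to a non-degenerate isotropic family is zero. -/
theorem eq_zero_of_innerD_of_omega {w : Fin n → DSpace n} (h1 : (nullFst w).det ≠ 0)
    (h2 : (nullSnd w).det ≠ 0) {z : DSpace n} (hi : ∀ i, innerD z (w i) = 0)
    (ho : ∀ i, omega z (w i) = 0) : z = 0 := by
  -- `innerD + omega` isolates the sum of `(z j).1 * (w i j).2`, and `innerD - omega` the other
  -- cross sum.
  have e1 : (nullSnd w).mulVec (fun j => (z j).1) = 0 := by
    ext i
    have := hi i
    have := ho i
    rw [innerD_eq] at *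
    rw [omega_eq] at *
    simp only [Matrix.mulVec, dotProduct, nullSnd, Matrix.of_apply, Pi.zero_apply,
      mul_comm ((w i _).2)]
    linarith
  have e2 : (nullFst w).mulVec (fun j => (z j).2) = 0 := by
    ext i
    have := hi i
    have := ho i
    rw [innerD_eq] at *
    rw [omega_eq] at *
    simp only [Matrix.mulVec, dotProduct, nullFst, Matrix.of_apply, Pi.zero_apply,
      mul_comm ((w i _).1)]
    linarith
  ext j
  · exact congrFun (Matrix.eq_zero_of_mulVec_eq_zero h2 e1) j
  · exact congrFun (Matrix.eq_zero_of_mulVec_eq_zero h1 e2) j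

/-! ## The phase of a family of vectors -/

/-- The phase of a family `w` with `dz w = (a, b)` in null coordinates is `(log |b| - log |a|) / 2`;
it depends only on the span of `w`. -/
def phaseOf (w : Fin n → DSpace n) : ℝ :=
  (Real.log (nullSnd w).det - Real.log (nullFst w).det) / 2

section Basis

variable {E : Type*} [AddCommGroup E] [Module ℝ E]

theorem nullFst_comp_basis (L : E →ₗ[ℝ] DSpace n) (b e : Module.Basis (Fin n) ℝ E) :
    nullFst (fun i => L (e i)) = (b.toMatrix e).transpose * nullFst fun i => L (b i) := by
  ext i j
  simp only [nullFst, Matrix.of_apply, Matrix.mul_apply, Matrix.transpose_apply]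
  rw [← b.sum_toMatrix_smul_self e i]
  simp only [map_sum, Finset.sum_apply, Prod.fst_sum, map_smul, Pi.smul_apply, Prod.smul_fst,
    smul_eq_mul]

theorem nullSnd_comp_basis (L : E →ₗ[ℝ] DSpace n) (b e : Module.Basis (Fin n) ℝ E) :
    nullSnd (fun i => L (e i)) = (b.toMatrix e).transpose * nullSnd fun i => L (b i) := by
  ext i j
  simp only [nullSnd, Matrix.of_apply, Matrix.mul_apply, Matrix.transpose_apply]
  rw [← b.sum_toMatrix_smul_self e i]
  simp only [map_sum, Finset.sum_apply, Prod.snd_sum, map_smul, Pi.smul_apply, Prod.smul_snd,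
    smul_eq_mul]

theorem det_nullFst_comp_basis (L : E →ₗ[ℝ] DSpace n) (b e : Module.Basis (Fin n) ℝ E) :
    (nullFst fun i => L (e i)).det = b.det e * (nullFst fun i => L (b i)).det := by
  rw [nullFst_comp_basis L b e, Matrix.det_mul, Matrix.det_transpose, Module.Basis.det_apply]

theorem det_nullSnd_comp_basis (L : E →ₗ[ℝ] DSpace n) (b e : Module.Basis (Fin n) ℝ E) :
    (nullSnd fun i => L (e i)).det = b.det e * (nullSnd fun i => L (b i)).det := by
  rw [nullSnd_comp_basis L b e, Matrix.det_mul, Matrix.det_transpose, Module.Basis.det_apply]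

/-- Both determinants acquire the same factor `b.det e`, whose logarithm cancels in the difference.
-/
theorem phaseOf_comp_basis (L : E →ₗ[ℝ] DSpace n) (b e : Module.Basis (Fin n) ℝ E)
    (h1 : (nullFst fun i => L (b i)).det ≠ 0) (h2 : (nullSnd fun i => L (b i)).det ≠ 0) :
    phaseOf (fun i => L (e i)) = phaseOf fun i => L (b i) := by
  have hd : b.det e ≠ 0 := (b.isUnit_det e).ne_zero
  rw [phaseOf, phaseOf, det_nullFst_comp_basis L b e, det_nullSnd_comp_basis L b e,
    Real.log_mul hd h2, Real.log_mul hd h1]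
  ring

end Basis

/-! ## The derivative of the phase -/

/-- Jacobi's formula: differentiate the Leibniz expansion factor by factor. By Cramer's rule the
`i`-th diagonal entry of `adj(A) A'` is the determinant of `A` with column `i` replaced by that of
`A'`, which collects the terms where the factor from column `i` was differentiated. -/
theorem hasDerivAt_det {A : ℝ → Matrix (Fin n) (Fin n) ℝ} {A' : Matrix (Fin n) (Fin n) ℝ} {t : ℝ}
    (h : ∀ i j, HasDerivAt (fun s => A s i j) (A' i j) t) :
    HasDerivAt (fun s => (A s).det) ((A t).adjugate * A').trace t := by
  have hs : HasDerivAt (fun s => ∑ σ : Equiv.Perm (Fin n), (Equiv.Perm.sign σ : ℝ) *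
      ∏ i, A s (σ i) i) (∑ σ : Equiv.Perm (Fin n), (Equiv.Perm.sign σ : ℝ) *
      ∑ i, (∏ j ∈ Finset.univ.erase i, A t (σ j) j) • A' (σ i) i) t :=
    HasDerivAt.fun_sum fun σ _ => (HasDerivAt.fun_finsetProd fun i _ => h (σ i) i).const_mul _
  have e : ((A t).adjugate * A').trace = ∑ σ : Equiv.Perm (Fin n), (Equiv.Perm.sign σ : ℝ) *
      ∑ i, (∏ j ∈ Finset.univ.erase i, A t (σ j) j) • A' (σ i) i := by
    have hc : ∀ i, ((A t).adjugate * A') i i = ((A t).updateCol i fun k => A' k i).det := by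
      intro i
      rw [← Matrix.cramer_apply, Matrix.cramer_eq_adjugate_mulVec]
      rfl
    simp only [Matrix.trace, Matrix.diag_apply, hc, Matrix.det_apply', Finset.mul_sum]
    rw [Finset.sum_comm]
    refine Finset.sum_congr rfl fun σ _ => Finset.sum_congr rfl fun i _ => ?_
    rw [← Finset.mul_prod_erase _ _ (Finset.mem_univ i), Matrix.updateCol_self, smul_eq_mul,
      mul_comm (A' (σ i) i)]
    congr 2
    refine Finset.prod_congr rfl fun j hj => ?_
    rw [Matrix.updateCol_ne (Finset.ne_of_mem_erase hj)]
  rw [e]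
  simpa only [Matrix.det_apply'] using hs

/-- No positivity is needed, since `Real.log` is `log |·|`. -/
theorem hasDerivAt_log_det {A : ℝ → Matrix (Fin n) (Fin n) ℝ} {A' : Matrix (Fin n) (Fin n) ℝ}
    {t : ℝ} (h : ∀ i j, HasDerivAt (fun s => A s i j) (A' i j) t) (hd : (A t).det ≠ 0) :
    HasDerivAt (fun s => Real.log (A s).det) ((A t)⁻¹ * A').trace t := by
  convert (hasDerivAt_det h).log hd using 1
  rw [Matrix.inv_def, Matrix.smul_mul, Matrix.trace_smul, Ring.inverse_eq_inv', smul_eq_mul,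
    div_eq_inv_mul]

/-- The derivative of the phase along a curve of families which is isotropic and non-degenerate at
the given time. -/
theorem hasDerivAt_phaseOf {w : ℝ → Fin n → DSpace n} {w' : Fin n → DSpace n} {t : ℝ}
    (h : ∀ i, HasDerivAt (fun s => w s i) (w' i) t) (hw : IsIsotropic (w t))
    (hg : (gramOf (w t)).det ≠ 0) :
    HasDerivAt (fun s => phaseOf (w s))
      (∑ i, ∑ j, (gramOf (w t))⁻¹ i j * omega (w t i) (w' j)) t := by
  have hd := hg
  rw [← hw.det_mul_det, mul_ne_zero_iff] at hd
  have h1 : ∀ i j, HasDerivAt (fun s => nullFst (w s) i j) (nullFst w' i j) t := fun i j =>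
    (hasDerivAt_pi.1 (h i) j).fst
  have h2 : ∀ i j, HasDerivAt (fun s => nullSnd (w s) i j) (nullSnd w' i j) t := fun i j =>
    (hasDerivAt_pi.1 (h i) j).snd
  refine (((hasDerivAt_log_det h2 hd.2).sub
    (hasDerivAt_log_det h1 hd.1)).div_const 2).congr_deriv ?_
  -- Writes the trace as a contraction of `G` with products of rows; the two instances, with `X` and
  -- `Y` from opposite null coordinates, are the two cross sums in `omega`.
  have key : ∀ X Y G : Matrix (Fin n) (Fin n) ℝ, (X.transpose * G * Y).trace =
      ∑ i, ∑ j, G i j * ∑ k, X i k * Y j k := by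
    intro X Y G
    rw [Matrix.mul_assoc, Matrix.trace_mul_comm]
    simp only [Matrix.trace, Matrix.diag_apply, Matrix.mul_apply, Matrix.transpose_apply,
      Finset.mul_sum, Finset.sum_mul]
    refine Finset.sum_congr rfl fun i _ => ?_
    rw [Finset.sum_comm]
    exact Finset.sum_congr rfl fun j _ => Finset.sum_congr rfl fun k _ => by ring
  rw [hw.inv_nullSnd hg, hw.inv_nullFst hg, key, key, ← Finset.sum_sub_distrib, Finset.sum_div]
  symm
  refine Finset.sum_congr rfl fun i _ => ?_
  rw [← Finset.sum_sub_distrib, Finset.sum_div]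
  refine Finset.sum_congr rfl fun j _ => ?_
  simp only [omega_eq, nullFst, nullSnd, Matrix.of_apply]
  ring

/-! ## Orthonormal frames -/

/-- A non-degenerate symmetric bilinear form over `ℝ` has an orthonormal basis. -/
theorem exists_orthonormal_basis {E : Type*} [AddCommGroup E] [Module ℝ E] [FiniteDimensional ℝ E]
    (hn : Module.finrank ℝ E = n) {B : LinearMap.BilinForm ℝ E} (hs : LinearMap.IsSymm B)
    (hB : B.SeparatingLeft) :
    ∃ e : Module.Basis (Fin n) ℝ E, (∀ i j, i ≠ j → B (e i) (e j) = 0) ∧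
      ∀ i, B (e i) (e i) = 1 ∨ B (e i) (e i) = -1 := by
  subst hn
  obtain ⟨v, hv⟩ := LinearMap.BilinForm.exists_orthogonal_basis hs
  have h0 : ∀ i, B (v i) (v i) ≠ 0 := hv.not_isOrtho_basis_self_of_separatingLeft hB
  have hu : ∀ i, IsUnit (√|B (v i) (v i)|)⁻¹ := fun i =>
    (inv_ne_zero (Real.sqrt_pos.2 (abs_pos.2 (h0 i))).ne').isUnit
  have hB' : ∀ i j, B (v.isUnitSMul hu i) (v.isUnitSMul hu j) =
      (√|B (v i) (v i)|)⁻¹ * ((√|B (v j) (v j)|)⁻¹ * B (v i) (v j)) := fun i j => by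
    simp only [Module.Basis.isUnitSMul_apply, map_smul, LinearMap.smul_apply, smul_eq_mul]
    ring
  refine ⟨v.isUnitSMul hu, fun i j hij => ?_, fun i => ?_⟩
  · rw [hB', show B (v i) (v j) = 0 from hv hij, mul_zero, mul_zero]
  · rw [hB', ← mul_assoc, ← mul_inv, Real.mul_self_sqrt (abs_nonneg _)]
    rcases lt_or_gt_of_ne (h0 i) with h | h
    · rw [abs_of_neg h]
      right
      rw [inv_neg, neg_mul, inv_mul_cancel₀ (h0 i)]
    · rw [abs_of_pos h]
      left
      exact inv_mul_cancel₀ (h0 i)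

variable {M : Type*} [TopologicalSpace M] [ChartedSpace (EuclideanSpace ℝ (Fin n)) M]

instance (x : M) : FiniteDimensional ℝ (TangentSpace (𝓡 n) x) :=
  inferInstanceAs (FiniteDimensional ℝ (EuclideanSpace ℝ (Fin n)))

theorem finrank_tangentSpace (x : M) : Module.finrank ℝ (TangentSpace (𝓡 n) x) = n :=
  finrank_euclideanSpace_fin (𝕜 := ℝ) (n := n)

/-- The differential of `f`, applied to a basis of the tangent space. -/
def pushBasis (f : M → DSpace n) (x : M) (b : Module.Basis (Fin n) ℝ (TangentSpace (𝓡 n) x)) :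
    Fin n → DSpace n :=
  fun i => differential f x (b i)

theorem det_nullSnd_pushBasis (f : M → DSpace n) (x : M)
    (b e : Module.Basis (Fin n) ℝ (TangentSpace (𝓡 n) x)) :
    (nullSnd (pushBasis f x e)).det = b.det e * (nullSnd (pushBasis f x b)).det :=
  det_nullSnd_comp_basis (differential f x).toLinearMap b e

theorem IsOrthonormalFrame.det_gramOf {f : M → DSpace n} {x : M}
    {e : Module.Basis (Fin n) ℝ (TangentSpace (𝓡 n) x)} (he : IsOrthonormalFrame f x e) :
    (gramOf (pushBasis f x e)).det = (-1) ^ numTimelike f x e := by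
  classical
  have hd : gramOf (pushBasis f x e) =
      Matrix.diagonal fun i => if firstForm f x (e i) (e i) < 0 then (-1 : ℝ) else 1 := by
    ext i j
    by_cases hij : i = j
    · subst hij
      rw [Matrix.diagonal_apply_eq]
      change firstForm f x (e i) (e i) = _
      rcases he.2 i with h | h <;> simp [h]
    · rw [Matrix.diagonal_apply_ne _ hij]
      exact he.1 i j hij
  rw [hd, Matrix.det_diagonal, Finset.prod_ite, Finset.prod_const, Finset.prod_const_one, mul_one]
  unfold numTimelike
  congr!

namespace IsNondegenerateLagrangian

variable {f : M → DSpace n} (hf : IsNondegenerateLagrangian f)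
include hf

theorem isIsotropic (x : M) (b : Module.Basis (Fin n) ℝ (TangentSpace (𝓡 n) x)) :
    IsIsotropic (pushBasis f x b) := fun _ _ => hf.lagrangian x _ _

/-- A left null vector of the Gram matrix is the coefficient vector of a tangent vector orthogonal
to the whole basis. -/
theorem det_gramOf_ne_zero (x : M) (b : Module.Basis (Fin n) ℝ (TangentSpace (𝓡 n) x)) :
    (gramOf (pushBasis f x b)).det ≠ 0 := by
  intro h
  obtain ⟨a, ha, h0⟩ := Matrix.exists_vecMul_eq_zero_iff.2 h
  have hB : ∀ v w, firstForm f x v w =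
      (innerBilin n).compl₁₂ (differential f x).toLinearMap (differential f x).toLinearMap v w :=
    fun _ _ => rfl
  have hz : ∑ i, a i • b i = 0 := by
    refine hf.nondegenerate x _ fun w => ?_
    rw [hB, ← b.sum_repr w, map_sum]
    refine Finset.sum_eq_zero fun j _ => ?_
    rw [map_smul, map_sum, LinearMap.sum_apply]
    have := congrFun h0 j
    simp only [Matrix.vecMul, dotProduct, gramOf, Matrix.of_apply, Pi.zero_apply] at this
    simp only [map_smul, LinearMap.smul_apply, smul_eq_mul, ← hB]
    exact mul_eq_zero_of_right _ this
  exact ha (funext fun i => Fintype.linearIndependent_iff.1 b.linearIndependent a hz i)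

theorem det_ne_zero (x : M) (b : Module.Basis (Fin n) ℝ (TangentSpace (𝓡 n) x)) :
    (nullFst (pushBasis f x b)).det ≠ 0 ∧ (nullSnd (pushBasis f x b)).det ≠ 0 := by
  rw [← mul_ne_zero_iff, (hf.isIsotropic x b).det_mul_det]
  exact hf.det_gramOf_ne_zero x b

theorem exists_isOrthonormalFrame (x : M) :
    ∃ e : Module.Basis (Fin n) ℝ (TangentSpace (𝓡 n) x), IsOrthonormalFrame f x e :=
  exists_orthonormal_basis (finrank_tangentSpace x)
    (B := (innerBilin n).compl₁₂ (differential f x).toLinearMap (differential f x).toLinearMap)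
    ⟨fun _ _ => innerD_comm _ _⟩ fun v hv => hf.nondegenerate x v hv

theorem phaseOf_pushBasis (x : M) (b e : Module.Basis (Fin n) ℝ (TangentSpace (𝓡 n) x)) :
    phaseOf (pushBasis f x e) = phaseOf (pushBasis f x b) :=
  phaseOf_comp_basis (differential f x).toLinearMap b e (hf.det_ne_zero x b).1
    (hf.det_ne_zero x b).2

end IsNondegenerateLagrangian

/-! ## The phase function, pointwise -/

/-- A basis of the tangent space. -/
def tangentBasis (x : M) : Module.Basis (Fin n) ℝ (TangentSpace (𝓡 n) x) :=
  (EuclideanSpace.basisFun (Fin n) ℝ).toBasis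

theorem tangentBasis_apply (x : M) (i : Fin n) : tangentBasis x i = coordVec x i := by
  change (EuclideanSpace.basisFun (Fin n) ℝ).toBasis i = EuclideanSpace.single i 1
  simp

/-- The phase of the tangent space at `x`. -/
def phase (f : M → DSpace n) (x : M) : ℝ := phaseOf (pushBasis f x (tangentBasis x))

/-- The sign of the second null coordinate of `dz` on a basis, corrected by the sign of the
basis. -/
def frameSign (f : M → DSpace n) (o : ∀ x : M, Orientation ℝ (TangentSpace (𝓡 n) x) (Fin n))
    (x : M) (b : Module.Basis (Fin n) ℝ (TangentSpace (𝓡 n) x)) : ℝ :=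
  volumeOnFrame o x b * SignType.sign (nullSnd (pushBasis f x b)).det

variable (o : ∀ x : M, Orientation ℝ (TangentSpace (𝓡 n) x) (Fin n))

theorem volumeOnFrame_eq_or (x : M) (b : Module.Basis (Fin n) ℝ (TangentSpace (𝓡 n) x)) :
    volumeOnFrame o x b = 1 ∨ volumeOnFrame o x b = -1 := by
  unfold volumeOnFrame
  split_ifs <;> simp

theorem volumeOnFrame_change (x : M) (b e : Module.Basis (Fin n) ℝ (TangentSpace (𝓡 n) x)) :
    volumeOnFrame o x e = SignType.sign (b.det e) * volumeOnFrame o x b := by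
  have hd : b.det e ≠ 0 := (b.isUnit_det e).ne_zero
  have hiff := b.orientation_eq_iff_det_pos e
  unfold volumeOnFrame
  rcases lt_or_gt_of_ne hd with h | h
  · have hne : e.orientation ≠ b.orientation := fun hh => h.not_gt (hiff.1 hh.symm)
    rw [b.orientation_ne_iff_eq_neg] at hne
    rw [sign_neg h]
    rcases b.orientation_eq_or_eq_neg (o x) with h1 | h1
    · simp [h1, hne, Module.Ray.ne_neg_self, ne_comm]
    · rw [hne, h1]
      simp [Module.Ray.ne_neg_self]
  · rw [hiff.2 h, sign_pos h]
    simp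

theorem IsNondegenerateLagrangian.frameSign_eq_or {f : M → DSpace n}
    (hf : IsNondegenerateLagrangian f) (x : M)
    (b : Module.Basis (Fin n) ℝ (TangentSpace (𝓡 n) x)) :
    frameSign f o x b = 1 ∨ frameSign f o x b = -1 := by
  unfold frameSign
  rcases lt_or_gt_of_ne (hf.det_ne_zero x b).2 with h | h <;>
    rcases volumeOnFrame_eq_or o x b with h1 | h1 <;> simp [h, h1]

/-- The orientation sign and the sign of the determinant both change by the sign of `b.det e`, and
the product of the two changes is `1`. -/
theorem frameSign_change (f : M → DSpace n) (x : M)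
    (b e : Module.Basis (Fin n) ℝ (TangentSpace (𝓡 n) x)) :
    frameSign f o x e = frameSign f o x b := by
  have hd : b.det e ≠ 0 := (b.isUnit_det e).ne_zero
  unfold frameSign
  rw [volumeOnFrame_change o x b e, det_nullSnd_pushBasis f x b e, sign_mul]
  rcases lt_or_gt_of_ne hd with h | h <;> simp [h]

/-- `τ^q` multiplies only the first null coordinate, by `(-1)^q`, and the two determinants have
product `(-1)^q`. -/
theorem IsOrthonormalFrame.tau_pow_smul_dz {f : M → DSpace n} (hf : IsNondegenerateLagrangian f)
    {x : M} {e : Module.Basis (Fin n) ℝ (TangentSpace (𝓡 n) x)} (he : IsOrthonormalFrame f x e) :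
    (tau ^ numTimelike f x e * dz fun i => differential f x (e i)) =
      ((nullSnd (pushBasis f x e)).det⁻¹, (nullSnd (pushBasis f x e)).det) := by
  have h := (hf.isIsotropic x e).det_mul_det.trans he.det_gramOf
  have h2 := (hf.det_ne_zero x e).2
  change tau ^ numTimelike f x e * dz (pushBasis f x e) = _
  rw [dz_eq]
  ext
  · simp only [Prod.fst_mul, Prod.pow_fst, tau]
    rw [← h, ← mul_eq_one_iff_eq_inv₀ h2, mul_assoc, h, ← mul_pow]
    simp
  · simp [tau]

/-- The logarithms of the two determinants add up to `log |(-1)^q| = 0`, so half their difference is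
the second one. -/
theorem IsOrthonormalFrame.phaseOf_eq {f : M → DSpace n} (hf : IsNondegenerateLagrangian f)
    {x : M} {e : Module.Basis (Fin n) ℝ (TangentSpace (𝓡 n) x)} (he : IsOrthonormalFrame f x e) :
    phaseOf (pushBasis f x e) = Real.log (nullSnd (pushBasis f x e)).det := by
  have h := (hf.isIsotropic x e).det_mul_det.trans he.det_gramOf
  have h2 := congrArg Real.log h
  rw [Real.log_mul (hf.det_ne_zero x e).1 (hf.det_ne_zero x e).2, Real.log_pow, Real.log_neg_eq_log,
    Real.log_one, mul_zero] at h2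
  unfold phaseOf
  linarith

theorem exp_smul_tau (t : ℝ) : NormedSpace.exp (t • tau) = (Real.exp (-t), Real.exp t) := by
  ext
  · rw [Prod.fst_exp, ← Real.exp_eq_exp_ℝ]
    simp [tau]
  · rw [Prod.snd_exp, ← Real.exp_eq_exp_ℝ]
    simp [tau]

/-- The absolute value of the second null coordinate removes both `σ` and the orientation sign, so
`θ` is determined whichever sign was chosen. -/
theorem IsPhaseFunction.eq_phase {f : M → DSpace n} (hf : IsNondegenerateLagrangian f)
    {o : ∀ x : M, Orientation ℝ (TangentSpace (𝓡 n) x) (Fin n)} {θ : M → ℝ}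
    (hθ : IsPhaseFunction f o θ) (x : M) : θ x = phase f x := by
  obtain ⟨σ, hσ, h⟩ := hθ
  obtain ⟨e, he⟩ := hf.exists_isOrthonormalFrame x
  have h1 := congrArg Prod.snd (h x e he)
  rw [he.tau_pow_smul_dz hf, exp_smul_tau] at h1
  simp only [Prod.smul_snd, smul_eq_mul] at h1
  have h2 : |(nullSnd (pushBasis f x e)).det| = Real.exp (θ x) := by
    have h3 := congrArg abs h1
    rw [abs_mul, abs_mul, abs_of_pos (Real.exp_pos _)] at h3
    rcases hσ with rfl | rfl <;> rcases volumeOnFrame_eq_or o x e with h4 | h4 <;>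
      simpa [h4] using h3
  rw [phase, hf.phaseOf_pushBasis x e, he.phaseOf_eq hf, ← Real.log_abs, h2, Real.log_exp]

theorem isPhaseFunction_phase {f : M → DSpace n} (hf : IsNondegenerateLagrangian f)
    {σ : ℝ} (hσ : σ = 1 ∨ σ = -1) (h : ∀ x, frameSign f o x (tangentBasis x) = σ) :
    IsPhaseFunction f o (phase f) := by
  refine ⟨σ, hσ, fun x e he => ?_⟩
  have h2 := (hf.det_ne_zero x e).2
  have hs := (frameSign_change o f x (tangentBasis x) e).trans (h x)
  rw [he.tau_pow_smul_dz hf, exp_smul_tau, phase, hf.phaseOf_pushBasis x e, he.phaseOf_eq hf,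
    Real.exp_neg, Real.exp_log_eq_abs h2, ← hs, frameSign]
  have hr : (SignType.sign (nullSnd (pushBasis f x e)).det : ℝ) * (nullSnd (pushBasis f x e)).det =
      |(nullSnd (pushBasis f x e)).det| := sign_mul_self _
  have hr' : (SignType.sign (nullSnd (pushBasis f x e)).det : ℝ) *
      (nullSnd (pushBasis f x e)).det⁻¹ = |(nullSnd (pushBasis f x e)).det|⁻¹ := by
    rcases lt_or_gt_of_ne h2 with h3 | h3
    · rw [abs_of_neg h3]
      simp [h3, inv_neg]
    · rw [abs_of_pos h3]
      simp [h3]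
  ext
  · simp only [Prod.smul_fst, smul_eq_mul, mul_assoc, hr']
  · simp only [Prod.smul_snd, smul_eq_mul, mul_assoc, hr]

/-! ## Derivatives in the ambient space -/

theorem hasDerivAt_omega {z w : ℝ → DSpace n} {z' w' : DSpace n} {t : ℝ} (hz : HasDerivAt z z' t)
    (hw : HasDerivAt w w' t) :
    HasDerivAt (fun s => omega (z s) (w s)) (omega z' (w t) + omega (z t) w')
      t := by
  have h1 : ∀ j, HasDerivAt (fun s => (z s j).1) (z' j).1 t := fun j =>
    (hasDerivAt_pi.1 hz j).fst
  have h2 : ∀ j, HasDerivAt (fun s => (z s j).2) (z' j).2 t := fun j =>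
    (hasDerivAt_pi.1 hz j).snd
  have h3 : ∀ j, HasDerivAt (fun s => (w s j).1) (w' j).1 t := fun j =>
    (hasDerivAt_pi.1 hw j).fst
  have h4 : ∀ j, HasDerivAt (fun s => (w s j).2) (w' j).2 t := fun j =>
    (hasDerivAt_pi.1 hw j).snd
  have h := ((HasDerivAt.fun_sum (u := Finset.univ) fun j _ => (h1 j).fun_mul (h4 j)).sub
    (HasDerivAt.fun_sum (u := Finset.univ) fun j _ => (h2 j).fun_mul (h3 j))).div_const 2
  simp only [omega_eq]
  refine h.congr_deriv ?_
  simp only [Finset.sum_add_distrib]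
  ring

theorem hasDerivAt_fderiv_line {F : EuclideanSpace ℝ (Fin n) → DSpace n}
    {p : EuclideanSpace ℝ (Fin n)} (hF : ContDiffAt ℝ ∞ F p) (c v : EuclideanSpace ℝ (Fin n)) :
    HasDerivAt (fun t : ℝ => fderiv ℝ F (p + t • c) v) (fderiv ℝ (fderiv ℝ F) p c v) 0 := by
  have h1 : DifferentiableAt ℝ (fderiv ℝ F) p :=
    (hF.fderiv_right (m := 1) (by norm_cast)).differentiableAt (by simp)
  have h2 : HasDerivAt (fun t : ℝ => p + t • c) c 0 := by
    simpa using ((hasDerivAt_id (0 : ℝ)).smul_const c).const_add p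
  have h3 : HasDerivAt (fun t : ℝ => fderiv ℝ F (p + t • c)) (fderiv ℝ (fderiv ℝ F) p c) 0 :=
    HasFDerivAt.comp_hasDerivAt_of_eq (x := (0 : ℝ)) h1.hasFDerivAt h2 (by simp)
  simpa using h3.clm_apply (hasDerivAt_const (0 : ℝ) v)

/-! ## The differential in a chart -/

/-- `f` in the chart at `x`. -/
def inChart (f : M → DSpace n) (x : M) : EuclideanSpace ℝ (Fin n) → DSpace n :=
  f ∘ (extChartAt (𝓡 n) x).symm

/-- The partial derivatives of `f` in the chart at `x`. -/
def partials (f : M → DSpace n) (x : M) (p : EuclideanSpace ℝ (Fin n)) : Fin n → DSpace n :=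
  fun i => fderiv ℝ (inChart f x) p (EuclideanSpace.single i 1)

theorem differential_self {f : M → DSpace n} {x : M}
    (hf : MDifferentiableAt (𝓡 n) 𝓘(ℝ, DSpace n) f x) (v : EuclideanSpace ℝ (Fin n)) :
    differential f x v = fderiv ℝ (inChart f x) (extChartAt (𝓡 n) x x) v := by
  unfold differential
  rw [hf.mfderiv]
  simp [writtenInExtChartAt, inChart, fderivWithin_univ]
  rfl

/-- All tangent spaces are the same model space, so the derivative at `y` can be regarded as one at
an equal point `z`, such as the image of `y` under a chart and back. -/
theorem hasMFDerivAt_of_eq {F : Type*} [NormedAddCommGroup F] [NormedSpace ℝ F] {f : M → F} {y z : M}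
    (hf : MDifferentiableAt (𝓡 n) 𝓘(ℝ, F) f y) (h : z = y) :
    HasMFDerivAt (𝓡 n) 𝓘(ℝ, F) f z
      (mfderiv (𝓡 n) 𝓘(ℝ, F) f y : EuclideanSpace ℝ (Fin n) →L[ℝ] F) := by
  subst h
  exact hf.hasMFDerivAt

theorem IsNondegenerateLagrangian.mdifferentiableAt {f : M → DSpace n}
    (hf : IsNondegenerateLagrangian f) (x : M) : MDifferentiableAt (𝓡 n) 𝓘(ℝ, DSpace n) f x :=
  hf.smooth.mdifferentiableAt (by simp)

theorem gram_eq (f : M → DSpace n) (x : M) :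
    gram f x = gramOf (pushBasis f x (tangentBasis x)) := by
  ext i j
  simp only [gram, gramOf, pushBasis, tangentBasis_apply, firstForm, Matrix.of_apply]

/-- What `normalPart` subtracts is tangential, and `ω` vanishes on pairs of tangent vectors. -/
theorem IsNondegenerateLagrangian.omega_normalPart {f : M → DSpace n}
    (hf : IsNondegenerateLagrangian f) (x : M) (w : DSpace n) (v : TangentSpace (𝓡 n) x) :
    omega (normalPart f x w) (differential f x v) = omega w (differential f x v) := by
  simp only [← omegaBilin_apply, normalPart, map_sub, LinearMap.sub_apply, map_sum, map_smul,
    LinearMap.sum_apply, LinearMap.smul_apply]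
  simp [hf.lagrangian x]

namespace IsNondegenerateLagrangian

variable {f : M → DSpace n} (hf : IsNondegenerateLagrangian f)
include hf

theorem partials_self (x : M) :
    partials f x (extChartAt (𝓡 n) x x) = pushBasis f x (tangentBasis x) := by
  ext1 i
  simp only [partials, pushBasis, tangentBasis_apply]
  exact (differential_self (hf.mdifferentiableAt x) _).symm

theorem innerD_normalPart (x : M) (w : DSpace n) (m : Fin n) :
    innerD (normalPart f x w) (differential f x (coordVec x m)) = 0 := by
  have hg : (gram f x)⁻¹ * gram f x = 1 := by
    rw [gram_eq]
    exact Matrix.nonsing_inv_mul _ (isUnit_iff_ne_zero.2 (hf.det_gramOf_ne_zero x _))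
  have hk : ∀ k, ∑ l, (gram f x)⁻¹ k l * innerD (differential f x (coordVec x l))
      (differential f x (coordVec x m)) = (1 : Matrix (Fin n) (Fin n) ℝ) k m := by
    intro k
    rw [← hg, Matrix.mul_apply]
    rfl
  simp only [← innerBilin_apply, normalPart, map_sub, LinearMap.sub_apply, map_sum, map_smul,
    LinearMap.sum_apply, LinearMap.smul_apply]
  simp only [innerBilin_apply, smul_eq_mul, mul_right_comm _ (innerD w _), ← Finset.sum_mul, hk]
  simp [Matrix.one_apply]

theorem innerD_meanCurvature (x : M) (m : Fin n) :
    innerD (meanCurvature f x) (differential f x (coordVec x m)) = 0 := by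
  rw [← innerBilin_apply]
  simp only [meanCurvature, map_sum, LinearMap.sum_apply, map_smul, LinearMap.smul_apply]
  simp [hf.innerD_normalPart x]

theorem omega_meanCurvature (x : M) (v : TangentSpace (𝓡 n) x) :
    omega (meanCurvature f x) (differential f x v) =
      ∑ i, ∑ j, (gram f x)⁻¹ i j * omega (secondDeriv f x i j) (differential f x v) := by
  rw [← omegaBilin_apply]
  simp only [meanCurvature, map_sum, LinearMap.sum_apply, map_smul, LinearMap.smul_apply,
    omegaBilin_apply, smul_eq_mul, hf.omega_normalPart x]

end IsNondegenerateLagrangian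

variable [IsManifold (𝓡 n) ∞ M]

/-- The identification of `ℝⁿ` with the tangent space at `y` given by the chart at `x`. -/
def chartEquiv (x y : M) (hy : y ∈ (chartAt (EuclideanSpace ℝ (Fin n)) x).source) :
    TangentSpace (𝓡 n) y ≃L[ℝ] EuclideanSpace ℝ (Fin n) :=
  (trivializationAt (EuclideanSpace ℝ (Fin n)) (TangentSpace (𝓡 n)) x).continuousLinearEquivAt ℝ y
    (by simpa using hy)

/-- The coordinate basis at `y` of the chart at `x`. -/
def chartBasis (x y : M) (hy : y ∈ (chartAt (EuclideanSpace ℝ (Fin n)) x).source) :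
    Module.Basis (Fin n) ℝ (TangentSpace (𝓡 n) y) :=
  (EuclideanSpace.basisFun (Fin n) ℝ).toBasis.map (chartEquiv x y hy).symm.toLinearEquiv

/-- The derivative of a function in the chart at `x`, at a point `y` of the domain of the chart. -/
theorem exists_hasFDerivAt_comp_symm {F : Type*} [NormedAddCommGroup F] [NormedSpace ℝ F] {f : M → F}
    {x y : M} (hf : MDifferentiableAt (𝓡 n) 𝓘(ℝ, F) f y)
    (hy : y ∈ (chartAt (EuclideanSpace ℝ (Fin n)) x).source) :
    ∃ L : EuclideanSpace ℝ (Fin n) →L[ℝ] F,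
      HasFDerivAt (f ∘ (extChartAt (𝓡 n) x).symm) L (extChartAt (𝓡 n) x y) ∧
        ∀ v, L v = mfderiv (𝓡 n) 𝓘(ℝ, F) f y ((chartEquiv x y hy).symm v) := by
  have hy' : y ∈ (extChartAt (𝓡 n) x).source := by simpa using hy
  have h1 := hasMFDerivAt_of_eq hf ((extChartAt (𝓡 n) x).left_inv hy')
  have h2 : MDifferentiableWithinAt 𝓘(ℝ, EuclideanSpace ℝ (Fin n)) (𝓡 n)
      (extChartAt (𝓡 n) x).symm (Set.range (𝓡 n)) (extChartAt (𝓡 n) x y) :=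
    mdifferentiableWithinAt_extChartAt_symm ((extChartAt (𝓡 n) x).map_source hy')
  have h3 := h2.hasMFDerivWithinAt
  -- The inverse of the tangent bundle trivialization is the derivative of the inverse chart.
  have e := TangentBundle.symmL_trivializationAt (I := 𝓡 n) hy
  have hr : Set.range (𝓡 n) = Set.univ := (𝓡 n).range_eq_univ
  rw [hr] at h3 e
  rw [hasMFDerivWithinAt_univ] at h3
  refine ⟨_, (h1.comp _ (h3.congr_mfderiv e.symm)).hasFDerivAt, fun v => ?_⟩
  exact congrArg (mfderiv (𝓡 n) 𝓘(ℝ, F) f y)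
    (congrFun (Bundle.Trivialization.symm_continuousLinearEquivAt_eq (R := ℝ) _ _) v).symm

theorem differential_chartEquiv_symm {f : M → DSpace n} {x y : M}
    (hf : MDifferentiableAt (𝓡 n) 𝓘(ℝ, DSpace n) f y)
    (hy : y ∈ (chartAt (EuclideanSpace ℝ (Fin n)) x).source) (v : EuclideanSpace ℝ (Fin n)) :
    differential f y ((chartEquiv x y hy).symm v) =
      fderiv ℝ (inChart f x) (extChartAt (𝓡 n) x y) v := by
  obtain ⟨L, hL, h⟩ := exists_hasFDerivAt_comp_symm hf hy
  rw [inChart, hL.fderiv, h]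
  rfl

theorem pushBasis_chartBasis {f : M → DSpace n} {x y : M}
    (hf : MDifferentiableAt (𝓡 n) 𝓘(ℝ, DSpace n) f y)
    (hy : y ∈ (chartAt (EuclideanSpace ℝ (Fin n)) x).source) :
    pushBasis f y (chartBasis x y hy) = partials f x (extChartAt (𝓡 n) x y) := by
  ext1 i
  simp only [pushBasis, chartBasis, partials, Module.Basis.map_apply]
  rw [← differential_chartEquiv_symm hf hy]
  simp

/-- In the chart at `x`, the coordinate basis of that chart has a constant orientation. -/
theorem IsManifoldOrientation.volumeOnFrame_chartBasis
    {o : ∀ x : M, Orientation ℝ (TangentSpace (𝓡 n) x) (Fin n)} (ho : IsManifoldOrientation o)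
    (x : M) : ∃ c : ℝ, ∀ᶠ y in 𝓝 x, ∀ hy : y ∈ (chartAt (EuclideanSpace ℝ (Fin n)) x).source,
      volumeOnFrame o y (chartBasis x y hy) = c := by
  classical
  refine ⟨volumeOnFrame o x (tangentBasis x), ?_⟩
  filter_upwards [ho x] with y hy hys
  have h := hy (by simpa using hys)
  have hiff : (chartBasis x y hys).orientation = o y ↔ (tangentBasis x).orientation = o x := by
    rw [← h, chartBasis, Module.Basis.orientation_map]
    change Orientation.map (Fin n) (chartEquiv x y hys).toLinearEquiv.symm _ = o y ↔
      _ = Orientation.map (Fin n) (chartEquiv x y hys).toLinearEquiv (o y)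
    rw [← Orientation.map_symm, Equiv.symm_apply_eq]
    rfl
  simp only [volumeOnFrame, hiff]

namespace IsNondegenerateLagrangian

variable {f : M → DSpace n} (hf : IsNondegenerateLagrangian f)
include hf

theorem contDiffOn_inChart (x : M) :
    ContDiffOn ℝ ∞ (inChart f x) (extChartAt (𝓡 n) x).target :=
  (hf.smooth.comp_contMDiffOn (contMDiffOn_extChartAt_symm x)).contDiffOn

theorem contDiffOn_partials (x : M) (i : Fin n) :
    ContDiffOn ℝ ∞ (fun p => partials f x p i) (extChartAt (𝓡 n) x).target :=
  ((hf.contDiffOn_inChart x).fderiv_of_isOpen (isOpen_extChartAt_target x) (by simp)).clm_apply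
    contDiffOn_const

theorem partials_eq_pushBasis (x : M) {p : EuclideanSpace ℝ (Fin n)}
    (hp : p ∈ (extChartAt (𝓡 n) x).target) :
    ∃ (y : M) (b : Module.Basis (Fin n) ℝ (TangentSpace (𝓡 n) y)),
      partials f x p = pushBasis f y b := by
  have hy : (extChartAt (𝓡 n) x).symm p ∈ (chartAt (EuclideanSpace ℝ (Fin n)) x).source := by
    simpa using (extChartAt (𝓡 n) x).map_target hp
  refine ⟨_, chartBasis x _ hy, ?_⟩
  rw [pushBasis_chartBasis (hf.mdifferentiableAt _), (extChartAt (𝓡 n) x).right_inv hp]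

theorem omega_fderiv (x : M) {p : EuclideanSpace ℝ (Fin n)}
    (hp : p ∈ (extChartAt (𝓡 n) x).target) (v w : EuclideanSpace ℝ (Fin n)) :
    omega (fderiv ℝ (inChart f x) p v) (fderiv ℝ (inChart f x) p w) = 0 := by
  have hy : (extChartAt (𝓡 n) x).symm p ∈ (chartAt (EuclideanSpace ℝ (Fin n)) x).source := by
    simpa using (extChartAt (𝓡 n) x).map_target hp
  have h := fun v => differential_chartEquiv_symm (hf.mdifferentiableAt _) hy v
  rw [(extChartAt (𝓡 n) x).right_inv hp] at h
  rw [← h, ← h]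
  exact hf.lagrangian _ _ _

theorem det_partials_ne_zero (x : M) {p : EuclideanSpace ℝ (Fin n)}
    (hp : p ∈ (extChartAt (𝓡 n) x).target) :
    (nullFst (partials f x p)).det ≠ 0 ∧ (nullSnd (partials f x p)).det ≠ 0 := by
  obtain ⟨y, b, h⟩ := hf.partials_eq_pushBasis x hp
  rw [h]
  exact hf.det_ne_zero y b

theorem contDiffOn_det_nullFst (x : M) :
    ContDiffOn ℝ ∞ (fun p => (nullFst (partials f x p)).det) (extChartAt (𝓡 n) x).target := by
  simp only [Matrix.det_apply']
  exact ContDiffOn.sum fun σ _ => contDiffOn_const.mul <| contDiffOn_prod fun i _ =>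
    (contDiffOn_pi.1 (hf.contDiffOn_partials x (σ i)) i).fst

theorem contDiffOn_det_nullSnd (x : M) :
    ContDiffOn ℝ ∞ (fun p => (nullSnd (partials f x p)).det) (extChartAt (𝓡 n) x).target := by
  simp only [Matrix.det_apply']
  exact ContDiffOn.sum fun σ _ => contDiffOn_const.mul <| contDiffOn_prod fun i _ =>
    (contDiffOn_pi.1 (hf.contDiffOn_partials x (σ i)) i).snd

theorem contDiffOn_phaseOf_partials (x : M) :
    ContDiffOn ℝ ∞ (fun p => phaseOf (partials f x p)) (extChartAt (𝓡 n) x).target :=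
  (((hf.contDiffOn_det_nullSnd x).log fun _ hp => (hf.det_partials_ne_zero x hp).2).sub
    ((hf.contDiffOn_det_nullFst x).log fun _ hp => (hf.det_partials_ne_zero x hp).1)).div_const 2

/-- The basis in `phase f y` depends on the preferred chart at `y`, which may jump with `y`;
independence of the basis allows a single chart to be used near `x`. -/
theorem phase_eq {x y : M} (hy : y ∈ (extChartAt (𝓡 n) x).source) :
    phase f y = phaseOf (partials f x (extChartAt (𝓡 n) x y)) := by
  rw [← pushBasis_chartBasis (hf.mdifferentiableAt _) (by simpa using hy), phase,
    hf.phaseOf_pushBasis]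

theorem contMDiff_phase : ContMDiff (𝓡 n) 𝓘(ℝ, ℝ) ∞ (phase f) := by
  intro x
  have h : ContMDiffOn (𝓡 n) 𝓘(ℝ, ℝ) ∞
      ((fun p => phaseOf (partials f x p)) ∘ extChartAt (𝓡 n) x) (chartAt _ x).source :=
    (hf.contDiffOn_phaseOf_partials x).contMDiffOn.comp (contMDiffOn_extChartAt) fun y hy =>
      (extChartAt (𝓡 n) x).map_source (by simpa using hy)
  refine (h.contMDiffAt (chart_source_mem_nhds _ x)).congr_of_eventuallyEq ?_
  filter_upwards [extChartAt_source_mem_nhds (I := 𝓡 n) x] with y hy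
  exact hf.phase_eq hy

/-- In the coordinate frame of one fixed chart the orientation sign is locally constant, and the
determinant is continuous and nonzero. -/
theorem isLocallyConstant_frameSign
    {o : ∀ x : M, Orientation ℝ (TangentSpace (𝓡 n) x) (Fin n)} (ho : IsManifoldOrientation o) :
    IsLocallyConstant fun x => frameSign f o x (tangentBasis x) := by
  rw [IsLocallyConstant.iff_eventually_eq]
  intro x
  obtain ⟨c, hc⟩ := ho.volumeOnFrame_chartBasis x
  have hx : extChartAt (𝓡 n) x x ∈ (extChartAt (𝓡 n) x).target := mem_extChartAt_target x
  have hcont : ContinuousAt (fun y => (nullSnd (partials f x (extChartAt (𝓡 n) x y))).det) x :=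
    ContinuousAt.comp (g := fun p => (nullSnd (partials f x p)).det)
      ((hf.contDiffOn_det_nullSnd x).continuousOn.continuousAt
        ((isOpen_extChartAt_target x).mem_nhds hx)) (continuousAt_extChartAt x)
  have hsign : ∀ᶠ y in 𝓝 x,
      SignType.sign (nullSnd (partials f x (extChartAt (𝓡 n) x y))).det =
        SignType.sign (nullSnd (partials f x (extChartAt (𝓡 n) x x))).det := by
    rcases lt_or_gt_of_ne (hf.det_partials_ne_zero x hx).2 with h | h
    · filter_upwards [hcont.eventually_lt_const h] with y hy
      rw [sign_neg h, sign_neg hy]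
    · filter_upwards [hcont.eventually_const_lt h] with y hy
      rw [sign_pos h, sign_pos hy]
  have key : ∀ᶠ y in 𝓝 x, frameSign f o y (tangentBasis y) =
      c * SignType.sign (nullSnd (partials f x (extChartAt (𝓡 n) x x))).det := by
    filter_upwards [hc, hsign, chart_source_mem_nhds (EuclideanSpace ℝ (Fin n)) x] with y h1 h2 hy
    rw [← frameSign_change o f y (tangentBasis y) (chartBasis x y hy), frameSign, h1 hy,
      pushBasis_chartBasis (hf.mdifferentiableAt _), h2]
  filter_upwards [key] with y hy
  rw [hy, key.self_of_nhds]

end IsNondegenerateLagrangian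

/-! ## The derivative of the phase function -/

namespace IsNondegenerateLagrangian

variable {f : M → DSpace n} (hf : IsNondegenerateLagrangian f)
include hf

theorem contDiffAt_inChart (x : M) : ContDiffAt ℝ ∞ (inChart f x) (extChartAt (𝓡 n) x x) :=
  (hf.contDiffOn_inChart x).contDiffAt (extChartAt_target_mem_nhds (I := 𝓡 n) x)

/-- The derivative of the Lagrangian condition. -/
theorem omega_secondDeriv (x : M) (a b c : EuclideanSpace ℝ (Fin n)) :
    omega (fderiv ℝ (inChart f x) (extChartAt (𝓡 n) x x) a)
        (fderiv ℝ (fderiv ℝ (inChart f x)) (extChartAt (𝓡 n) x x) c b) =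
      -omega (fderiv ℝ (fderiv ℝ (inChart f x)) (extChartAt (𝓡 n) x x) c a)
        (fderiv ℝ (inChart f x) (extChartAt (𝓡 n) x x) b) := by
  have hF := hf.contDiffAt_inChart x
  have h := hasDerivAt_omega (hasDerivAt_fderiv_line hF c a) (hasDerivAt_fderiv_line hF c b)
  have h0 : (fun t : ℝ => omega (fderiv ℝ (inChart f x) (extChartAt (𝓡 n) x x + t • c) a)
      (fderiv ℝ (inChart f x) (extChartAt (𝓡 n) x x + t • c) b)) =ᶠ[𝓝 0] fun _ => 0 := by
    have hc : ContinuousAt (fun t : ℝ => extChartAt (𝓡 n) x x + t • c) 0 := by fun_prop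
    have := hc.preimage_mem_nhds (t := (extChartAt (𝓡 n) x).target)
      (by simpa using extChartAt_target_mem_nhds (I := 𝓡 n) x)
    filter_upwards [this] with t ht
    exact hf.omega_fderiv x ht a b
  have := (h.congr_of_eventuallyEq h0.symm).unique (hasDerivAt_const (0 : ℝ) (0 : ℝ))
  simp only [zero_smul, add_zero] at this
  linarith

theorem fderiv_phaseOf_partials (x : M) (v : EuclideanSpace ℝ (Fin n)) :
    fderiv ℝ (fun p => phaseOf (partials f x p)) (extChartAt (𝓡 n) x x) v =
      -omega (meanCurvature f x) (fderiv ℝ (inChart f x) (extChartAt (𝓡 n) x x) v) := by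
  have hF := hf.contDiffAt_inChart x
  have hd : DifferentiableAt ℝ (fun p => phaseOf (partials f x p)) (extChartAt (𝓡 n) x x) :=
    ((hf.contDiffOn_phaseOf_partials x).contDiffAt
      (extChartAt_target_mem_nhds x)).differentiableAt (by simp)
  have h2 : HasDerivAt (fun t : ℝ => extChartAt (𝓡 n) x x + t • v) v 0 := by
    simpa using ((hasDerivAt_id (0 : ℝ)).smul_const v).const_add (extChartAt (𝓡 n) x x)
  have h3 := HasFDerivAt.comp_hasDerivAt_of_eq (x := (0 : ℝ)) hd.hasFDerivAt h2 (by simp)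
  have h0 : partials f x (extChartAt (𝓡 n) x x + (0 : ℝ) • v) =
      pushBasis f x (tangentBasis x) := by
    rw [zero_smul, add_zero, hf.partials_self]
  have h4 := hasDerivAt_phaseOf (w := fun t : ℝ => partials f x (extChartAt (𝓡 n) x x + t • v))
    (fun i => hasDerivAt_fderiv_line hF v (EuclideanSpace.single i 1))
    (by rw [h0]; exact hf.isIsotropic x _) (by rw [h0]; exact hf.det_gramOf_ne_zero x _)
  have hm := hf.omega_meanCurvature x v
  rw [differential_self (hf.mdifferentiableAt x)] at hm
  rw [h3.unique h4, hm, ← Finset.sum_neg_distrib, Finset.sum_comm]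
  refine Finset.sum_congr rfl fun i _ => ?_
  rw [← Finset.sum_neg_distrib]
  refine Finset.sum_congr rfl fun j _ => ?_
  have hsymm : IsSymmSndFDerivAt ℝ (inChart f x) (extChartAt (𝓡 n) x x) :=
    hF.isSymmSndFDerivAt (by simpa using (by exact_mod_cast le_top : ((2 : ℕ∞) : WithTop ℕ∞) ≤ ∞))
  have hg : (gram f x)⁻¹ j i = (gram f x)⁻¹ i j := by
    rw [← Matrix.transpose_apply (gram f x)⁻¹ i j, Matrix.transpose_nonsing_inv, gram_eq,
      gramOf_transpose]
  -- Symmetry moves the direction `v` to the second slot of the second derivative; the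
  -- differentiated Lagrangian condition then moves the second derivative into the first slot of
  -- `omega`, leaving the first derivative along `v` in the second.
  rw [h0, ← gram_eq, hg, hsymm.eq, ← hf.partials_self, partials, hf.omega_secondDeriv, mul_neg]
  rfl

theorem mfderiv_phase (x : M) (v : TangentSpace (𝓡 n) x) :
    mfderiv (𝓡 n) 𝓘(ℝ, ℝ) (phase f) x v =
      -omega (meanCurvature f x) (differential f x v) := by
  refine Eq.trans ?_ ((hf.fderiv_phaseOf_partials x v).trans
    (congrArg (fun z => -omega (meanCurvature f x) z)
      (differential_self (hf.mdifferentiableAt x) v).symm))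
  refine (DFunLike.congr_fun (hf.contMDiff_phase.mdifferentiable (by simp) x).mfderiv v).trans ?_
  have he : phase f ∘ (extChartAt (𝓡 n) x).symm =ᶠ[𝓝 (extChartAt (𝓡 n) x x)]
      fun p => phaseOf (partials f x p) := by
    filter_upwards [extChartAt_target_mem_nhds (I := 𝓡 n) x] with p hp
    rw [Function.comp_apply, hf.phase_eq ((extChartAt (𝓡 n) x).map_target hp),
      (extChartAt (𝓡 n) x).right_inv hp]
  rw [← he.fderiv_eq]
  simp [writtenInExtChartAt, fderivWithin_univ]
  rfl

end IsNondegenerateLagrangian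

/-- A function on a connected manifold with vanishing derivative is constant. -/
theorem exists_eq_const_of_mfderiv_eq_zero [ConnectedSpace M] {θ : M → ℝ}
    (hθ : MDifferentiable (𝓡 n) 𝓘(ℝ, ℝ) θ) (h : ∀ x, mfderiv (𝓡 n) 𝓘(ℝ, ℝ) θ x = 0) :
    ∃ c : ℝ, ∀ x, θ x = c := by
  have hl : IsLocallyConstant θ := by
    rw [IsLocallyConstant.iff_eventually_eq]
    intro x
    -- A ball inside the chart image is convex, so a vanishing derivative there forces constancy.
    obtain ⟨r, hr, hb⟩ := Metric.mem_nhds_iff.1 (extChartAt_target_mem_nhds (I := 𝓡 n) x)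
    have hd : ∀ p ∈ Metric.ball (extChartAt (𝓡 n) x x) r,
        HasFDerivAt (θ ∘ (extChartAt (𝓡 n) x).symm)
          (0 : EuclideanSpace ℝ (Fin n) →L[ℝ] ℝ) p := by
      intro p hp
      have hy : (extChartAt (𝓡 n) x).symm p ∈ (chartAt (EuclideanSpace ℝ (Fin n)) x).source := by
        simpa using (extChartAt (𝓡 n) x).map_target (hb hp)
      obtain ⟨L, hL, hL'⟩ := exists_hasFDerivAt_comp_symm (hθ _) hy
      rw [(extChartAt (𝓡 n) x).right_inv (hb hp)] at hL
      refine hL.congr_fderiv (ContinuousLinearMap.ext fun v => ?_)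
      rw [hL', h]
      rfl
    have hball : Metric.ball (extChartAt (𝓡 n) x x) r ∈ 𝓝 (extChartAt (𝓡 n) x x) :=
      Metric.ball_mem_nhds _ hr
    filter_upwards [(continuousAt_extChartAt (I := 𝓡 n) x).preimage_mem_nhds hball,
      extChartAt_source_mem_nhds (I := 𝓡 n) x] with y hy hys
    have hc := (convex_ball (extChartAt (𝓡 n) x x) r).is_const_of_fderivWithin_eq_zero (𝕜 := ℝ)
      (fun p hp => (hd p hp).differentiableAt.differentiableWithinAt)
      (fun p hp => by
        rw [fderivWithin_of_isOpen Metric.isOpen_ball hp, (hd p hp).fderiv]) hy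
      (Metric.mem_ball_self hr)
    simp only [Function.comp_apply] at hc
    rwa [(extChartAt (𝓡 n) x).left_inv hys, extChartAt_to_inv] at hc
  obtain ⟨x₀⟩ := (inferInstance : Nonempty M)
  exact ⟨θ x₀, fun x => hl.apply_eq_of_isPreconnected isPreconnected_univ trivial trivial⟩

theorem IsNondegenerateLagrangian.meanCurvature_eq_zero_iff [ConnectedSpace M] {f : M → DSpace n}
    (hf : IsNondegenerateLagrangian f) :
    (∀ x, meanCurvature f x = 0) ↔ ∃ c : ℝ, ∀ x, phase f x = c := by
  constructor
  · intro h
    refine exists_eq_const_of_mfderiv_eq_zero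
      (hf.contMDiff_phase.mdifferentiable (by simp)) fun x => ?_
    ext v
    rw [hf.mfderiv_phase, h, ← omegaBilin_apply, map_zero, LinearMap.zero_apply, neg_zero]
    rfl
  · rintro ⟨c, hc⟩ x
    have hp : phase f = fun _ => c := funext hc
    have hd := hf.det_ne_zero x (tangentBasis x)
    -- Metric orthogonality holds for any mean curvature vector; the `omega` part is where constancy
    -- of the phase enters.
    refine eq_zero_of_innerD_of_omega hd.1 hd.2 (fun i => ?_) fun i => ?_
    · simp only [pushBasis, tangentBasis_apply]
      exact hf.innerD_meanCurvature x i
    · have h := hf.mfderiv_phase x (tangentBasis x i)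
      rw [hp, mfderiv_const] at h
      exact neg_eq_zero.1 h.symm

end SplitLag

end

theorem proposition16p3 {n : ℕ} {M : Type*} [TopologicalSpace M]
    [ChartedSpace (EuclideanSpace ℝ (Fin n)) M] [IsManifold (𝓡 n) ∞ M] [ConnectedSpace M]
    (o : ∀ x : M, Orientation ℝ (TangentSpace (𝓡 n) x) (Fin n))
    (ho : SplitLag.IsManifoldOrientation o)
    (f : M → SplitLag.DSpace n) (hf : SplitLag.IsNondegenerateLagrangian f) :
    (∃! θ : M → ℝ, SplitLag.IsPhaseFunction f o θ) ∧
    ∀ θ : M → ℝ, SplitLag.IsPhaseFunction f o θ →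
      ContMDiff (𝓡 n) 𝓘(ℝ, ℝ) ∞ θ ∧
      (∀ (x : M) (v : TangentSpace (𝓡 n) x),
        mfderiv (𝓡 n) 𝓘(ℝ, ℝ) θ x v =
          -SplitLag.innerD (SplitLag.opT (SplitLag.differential f x v))
            (SplitLag.meanCurvature f x)) ∧
      (∀ (x : M) (v : TangentSpace (𝓡 n) x),
        mfderiv (𝓡 n) 𝓘(ℝ, ℝ) θ x v =
          -SplitLag.omega (SplitLag.meanCurvature f x) (SplitLag.differential f x v)) ∧
      ((∀ x, SplitLag.meanCurvature f x = 0) ↔ ∃ c : ℝ, ∀ x, θ x = c) := by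
  constructor
  · refine ⟨SplitLag.phase f, ?_, fun θ hθ => funext fun x => hθ.eq_phase hf x⟩
    obtain ⟨x₀⟩ := (inferInstance : Nonempty M)
    -- The global sign `σ` is the frame sign at an arbitrary base point `x₀`.
    exact SplitLag.isPhaseFunction_phase o hf (hf.frameSign_eq_or o x₀ (SplitLag.tangentBasis x₀))
      fun x => (hf.isLocallyConstant_frameSign ho).apply_eq_of_isPreconnected
        isPreconnected_univ trivial trivial
  · intro θ hθ
    obtain rfl : θ = SplitLag.phase f := funext fun x => hθ.eq_phase hf x
    refine ⟨hf.contMDiff_phase, fun x v => ?_, hf.mfderiv_phase, hf.meanCurvature_eq_zero_iff⟩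
    rw [SplitLag.innerD_opT, hf.mfderiv_phase]
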